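/- Let $r\ge 2$ be an integer, $\mathcal A=\{0,\dots,r-1\}$ and $\Omega=\mathcal A^{\{1,2,\dots\}}$, with the metric $d(x,y)=2^{-\min\{n\ge 1\,:\,x_n\ne y_n\}}$ for $x\neq y$ and $d(x,x)=0$; for $a\in\mathcal A$ and $x\in\Omega$ write $ax=(a,x_1,x_2,\dots)$. Let $\beta>0$, $\mu<0$ and let $(A_N)_{N\ge 0}$ be functions $A_N:\Omega\to\mathbb R$ such that (H1) there is $M>0$ with $|A_N(x)-A_N(y)|\le M\,d(x,y)$ for all $x,y\in\Omega$ and all $N\ge 0$; (H3) $A_N(x)>\left(\frac{\log r}{\beta}+\mu\right)N$ for all $x\in\Omega$ and all $N\ge 0$. Let $\mathcal L_{\beta,\mu}:C(\Omega)\to C(\Omega)$ be the bounded linear operator $$\mathcal L_{\beta,\mu}(f)(x)=\sum_{N\ge 0}e^{\beta\mu N}\sum_{a\in\mathcal A}e^{-\beta A_N(ax)}f(ax),$$ and let $\mathcal L_{\beta,\mu}^*:C(\Omega)^*\to C(\Omega)^*$ be its dual, where a Borel probability measure $\nu$ on $\Omega$ is identified with the functional $f\mapsto\int f\,d\nu$.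 For $j\in\mathbb N_0=\{0,1,2,\dots\}$ put $\phi_j(x)=(j \bmod r)\,x$, $\xi(j)=\frac{j-(j\bmod r)}{r}$ and $q_j(x)=-\beta\bigl(A_{\xi(j)}(\phi_j(x))-\xi(j)\mu\bigr)$, and let $Q=(q_j)_{j\ge 0}$. For a word $w=(w_1,\dots,w_n)$ let $\phi_w=\phi_{w_1}\circ\cdots\circ\phi_{w_n}$ (the identity for the empty word) and $\sigma^j(w)=(w_{j+1},\dots,w_n)$. For $n\ge 1$ let $$Z_n(Q)=\sum_{w\in\mathbb N_0^n}\exp\Bigl(\sup_{x\in\Omega}\sum_{j=1}^n q_{w_j}\bigl(\phi_{\sigma^j(w)}(x)\bigr)\Bigr).$$ Then $Z_n(Q)<\infty$ for every $n\ge 1$, and the topological pressure $$P(Q)=\lim_{n\to\infty}\frac1n\log Z_n(Q)=\inf_{n\ge 1}\frac1n\log Z_n(Q)$$ exists as a real number. There are a Borel probability measure $\nu$ on $\Omega$ and a $\lambda\in\mathbb R$ with $\mathcal L_{\beta,\mu}^*(\nu)=\lambda\nu$, and for every such pair $(\nu,\lambda)$, $$\lambda=e^{P(Q)}.$$ -/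

import Mathlib

open Filter Topology MeasureTheory

/-- The symbolic space of one-sided sequences over the alphabet with `r` letters, with the product
topology and the product (equivalently, Borel) sigma-algebra. The coordinate `x n` is the letter
usually written with index `n + 1`. -/
abbrev SymbSpace (r : ℕ) : Type := ℕ → Fin r

open Classical in
/-- The metric `d(x, y) = 2 ^ (- min {n ≥ 1 : x_n ≠ y_n})`, and `d(x, x) = 0`
(`PiNat.firstDiff` counts coordinates from `0`, hence the `+ 1`). -/
noncomputable def symbDist {r : ℕ} (x y : SymbSpace r) : ℝ :=
  if x = y then 0 else (1 / 2 : ℝ) ^ (PiNat.firstDiff x y + 1)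

/-- The sequence `a x = (a, x_1, x_2, ...)`. -/
def prepend {r : ℕ} (a : Fin r) (x : SymbSpace r) : SymbSpace r
  | 0 => a
  | n + 1 => x n

/-- Uniform Lipschitz condition: every `A_N` is Lipschitz with constant at most `M`. -/
def UniformlyLipschitz {r : ℕ} (A : ℕ → SymbSpace r → ℝ) (M : ℝ) : Prop :=
  ∀ N x y, |A N x - A N y| ≤ M * symbDist x y

/-- Strong superlinearity: `A_N(x) > K' N + δ` for all `x` and all `N ≥ 0`. -/
def StronglySuperlinear {r : ℕ} (A : ℕ → SymbSpace r → ℝ) (K' δ : ℝ) : Prop :=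
  ∀ (N : ℕ) (x : SymbSpace r), K' * N + δ < A N x

/-- Admissibility: `∑_N e^{βμN} ∑_a e^{-β A_N(ax)} < ∞` for every `x`. -/
def Admissible {r : ℕ} (β μ : ℝ) (A : ℕ → SymbSpace r → ℝ) : Prop :=
  ∀ x : SymbSpace r,
    Summable fun N : ℕ => Real.exp (β * μ * N) * ∑ a : Fin r, Real.exp (-β * A N (prepend a x))

theorem symbDist_le_one {r : ℕ} (x y : SymbSpace r) : symbDist x y ≤ 1 := by
  unfold symbDist
  split_ifs
  · exact zero_le_one
  · exact pow_le_one₀ (by norm_num) (by norm_num)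

theorem symbDist_nonneg {r : ℕ} (x y : SymbSpace r) : 0 ≤ symbDist x y := by
  unfold symbDist
  split_ifs
  · exact le_rfl
  · positivity

theorem continuous_prepend {r : ℕ} (a : Fin r) : Continuous (prepend a) := by
  refine continuous_pi fun n => ?_
  cases n with
  | zero => exact continuous_const
  | succ n => exact continuous_apply n

theorem UniformlyLipschitz.continuous {r : ℕ} {A : ℕ → SymbSpace r → ℝ} {M : ℝ}
    (h : UniformlyLipschitz A M) (N : ℕ) : Continuous (A N) := by
  rw [continuous_iff_continuousAt]
  intro x
  rw [ContinuousAt, Metric.tendsto_nhds]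
  intro ε hε
  obtain ⟨n, hn⟩ := exists_pow_lt_of_lt_one (div_pos hε (by positivity : (0 : ℝ) < |M| + 1))
    (by norm_num : (1 / 2 : ℝ) < 1)
  have hmem : PiNat.cylinder x n ∈ 𝓝 x :=
    (PiNat.isOpen_cylinder _ x n).mem_nhds (PiNat.self_mem_cylinder x n)
  filter_upwards [hmem] with y hy
  have hd : symbDist y x ≤ (1 / 2 : ℝ) ^ n := by
    unfold symbDist
    split_ifs with hxy
    · positivity
    · have := (PiNat.mem_cylinder_iff_le_firstDiff hxy n).1 hy
      exact pow_le_pow_of_le_one (by norm_num) (by norm_num) (by omega)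
  have h0 := symbDist_nonneg y x
  rw [Real.dist_eq]
  rw [lt_div_iff₀ (by positivity)] at hn
  calc |A N y - A N x| ≤ M * symbDist y x := h N y x
    _ ≤ (|M| + 1) * symbDist y x :=
        mul_le_mul_of_nonneg_right (by linarith [le_abs_self M]) h0
    _ ≤ (|M| + 1) * (1 / 2 : ℝ) ^ n := mul_le_mul_of_nonneg_left hd (by positivity)
    _ < ε := by linarith

/-- The `N`-th term of the grand-canonical Ruelle operator. -/
noncomputable def ruelleTerm {r : ℕ} (β μ : ℝ) (A : ℕ → SymbSpace r → ℝ) (f : SymbSpace r → ℝ)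
    (x : SymbSpace r) (N : ℕ) : ℝ :=
  Real.exp (β * μ * N) * ∑ a : Fin r, Real.exp (-β * A N (prepend a x)) * f (prepend a x)

theorem abs_ruelleTerm_le {r : ℕ} {β μ M : ℝ} (hβ : 0 < β) (hM : 0 < M)
    {A : ℕ → SymbSpace r → ℝ} (h1 : UniformlyLipschitz A M) (f : C(SymbSpace r, ℝ))
    (x y : SymbSpace r) (N : ℕ) :
    |ruelleTerm β μ A f x N| ≤ (Real.exp (β * M) * (Real.exp (β * μ * N) *
      ∑ a : Fin r, Real.exp (-β * A N (prepend a y)))) * ‖f‖ := by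
  have key : ∀ a : Fin r, |Real.exp (-β * A N (prepend a x)) * f (prepend a x)| ≤
      Real.exp (β * M) * Real.exp (-β * A N (prepend a y)) * ‖f‖ := by
    intro a
    rw [abs_mul, abs_of_pos (Real.exp_pos _)]
    refine mul_le_mul ?_ (f.norm_coe_le_norm _) (abs_nonneg _) (by positivity)
    rw [← Real.exp_add]
    refine Real.exp_le_exp.2 ?_
    have h := (abs_le.1 (h1 N (prepend a x) (prepend a y))).1
    have hd := symbDist_le_one (prepend a x) (prepend a y)
    nlinarith [mul_le_mul_of_nonneg_left hd hM.le]
  unfold ruelleTerm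
  rw [abs_mul, abs_of_pos (Real.exp_pos _)]
  calc Real.exp (β * μ * N) * |∑ a : Fin r, Real.exp (-β * A N (prepend a x)) * f (prepend a x)|
      ≤ Real.exp (β * μ * N) *
          ∑ a : Fin r, Real.exp (β * M) * Real.exp (-β * A N (prepend a y)) * ‖f‖ :=
        mul_le_mul_of_nonneg_left
          ((Finset.abs_sum_le_sum_abs _ _).trans (Finset.sum_le_sum fun a _ => key a))
          (Real.exp_pos _).le
    _ = _ := by rw [← Finset.sum_mul, ← Finset.mul_sum]; ring

theorem summable_ruelleTerm {r : ℕ} {β μ M : ℝ} (hβ : 0 < β) (hM : 0 < M)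
    {A : ℕ → SymbSpace r → ℝ} (h1 : UniformlyLipschitz A M) (hA : Admissible β μ A)
    (f : C(SymbSpace r, ℝ)) (x : SymbSpace r) : Summable (ruelleTerm β μ A f x) :=
  Summable.of_norm_bounded (((hA x).mul_left _).mul_right _)
    fun N => abs_ruelleTerm_le hβ hM h1 f x x N

theorem continuous_tsum_ruelleTerm {r : ℕ} {β μ M : ℝ} (hβ : 0 < β) (hM : 0 < M)
    {A : ℕ → SymbSpace r → ℝ} (h1 : UniformlyLipschitz A M) (hA : Admissible β μ A)
    (f : C(SymbSpace r, ℝ)) : Continuous fun x => ∑' N : ℕ, ruelleTerm β μ A f x N := by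
  rcases isEmpty_or_nonempty (SymbSpace r) with hE | ⟨⟨x₀⟩⟩
  · exact continuous_of_const fun x => hE.elim x
  · refine continuous_tsum (fun N => ?_) (((hA x₀).mul_left _).mul_right _)
      fun N x => abs_ruelleTerm_le hβ hM h1 f x x₀ N
    unfold ruelleTerm
    refine continuous_const.mul (continuous_finsetSum _ fun a _ => ?_)
    exact (Real.continuous_exp.comp (continuous_const.mul
      ((h1.continuous N).comp (continuous_prepend a)))).mul
      (f.continuous.comp (continuous_prepend a))

/-- The grand-canonical Ruelle operator as a linear map on `C(Ω)`:
`L f (x) = ∑_N e^{βμN} ∑_a e^{-β A_N(ax)} f(ax)`. -/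
noncomputable def ruelleLinear {r : ℕ} {β μ M : ℝ} (hβ : 0 < β) (hM : 0 < M)
    {A : ℕ → SymbSpace r → ℝ} (h1 : UniformlyLipschitz A M) (hA : Admissible β μ A) :
    C(SymbSpace r, ℝ) →ₗ[ℝ] C(SymbSpace r, ℝ) where
  toFun f := ⟨fun x => ∑' N : ℕ, ruelleTerm β μ A f x N, continuous_tsum_ruelleTerm hβ hM h1 hA f⟩
  map_add' f g := by
    ext x
    have : ruelleTerm β μ A (f + g : C(SymbSpace r, ℝ)) x =
        fun N => ruelleTerm β μ A f x N + ruelleTerm β μ A g x N := by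
      funext N
      simp only [ruelleTerm, ContinuousMap.add_apply, mul_add, Finset.sum_add_distrib]
    simp only [ContinuousMap.coe_mk, ContinuousMap.add_apply, this]
    exact (summable_ruelleTerm hβ hM h1 hA f x).tsum_add (summable_ruelleTerm hβ hM h1 hA g x)
  map_smul' c f := by
    ext x
    have : ruelleTerm β μ A (c • f : C(SymbSpace r, ℝ)) x =
        fun N => c * ruelleTerm β μ A f x N := by
      funext N
      simp only [ruelleTerm, ContinuousMap.smul_apply, smul_eq_mul, mul_left_comm _ c,
        ← Finset.mul_sum]
    simp only [ContinuousMap.coe_mk, ContinuousMap.smul_apply, this, RingHom.id_apply, smul_eq_mul]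
    exact tsum_mul_left

theorem exists_bound_ruelleLinear {r : ℕ} {β μ M : ℝ} (hβ : 0 < β) (hM : 0 < M)
    {A : ℕ → SymbSpace r → ℝ} (h1 : UniformlyLipschitz A M) (hA : Admissible β μ A) :
    ∃ C : ℝ, ∀ f, ‖ruelleLinear hβ hM h1 hA f‖ ≤ C * ‖f‖ := by
  rcases isEmpty_or_nonempty (SymbSpace r) with hE | ⟨⟨x₀⟩⟩
  · refine ⟨0, fun f => ?_⟩
    rw [zero_mul]
    exact (ContinuousMap.norm_le _ le_rfl).2 fun x => hE.elim x
  · have hs := (hA x₀).mul_left (Real.exp (β * M))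
    refine ⟨∑' N : ℕ, Real.exp (β * M) * (Real.exp (β * μ * N) *
      ∑ a : Fin r, Real.exp (-β * A N (prepend a x₀))), fun f => ?_⟩
    have hC : 0 ≤ ∑' N : ℕ, Real.exp (β * M) * (Real.exp (β * μ * N) *
        ∑ a : Fin r, Real.exp (-β * A N (prepend a x₀))) :=
      tsum_nonneg fun N => by positivity
    refine (ContinuousMap.norm_le _ (mul_nonneg hC (norm_nonneg _))).2 fun x => ?_
    rw [← tsum_mul_right]
    exact tsum_of_norm_bounded (hs.mul_right _).hasSum
      fun N => abs_ruelleTerm_le hβ hM h1 f x x₀ N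

/-- The grand-canonical Ruelle operator as a bounded operator on `C(Ω)`. -/
noncomputable def ruelleOp {r : ℕ} {β μ M : ℝ} (hβ : 0 < β) (hM : 0 < M)
    {A : ℕ → SymbSpace r → ℝ} (h1 : UniformlyLipschitz A M) (hA : Admissible β μ A) :
    C(SymbSpace r, ℝ) →L[ℝ] C(SymbSpace r, ℝ) :=
  (ruelleLinear hβ hM h1 hA).mkContinuousOfExistsBound (exists_bound_ruelleLinear hβ hM h1 hA)

/-- The dual operator `L* : C(Ω)* → C(Ω)*`, `L*(ℓ) = ℓ ∘ L`. -/
noncomputable def dualRuelleOp {r : ℕ} {β μ M : ℝ} (hβ : 0 < β) (hM : 0 < M)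
    {A : ℕ → SymbSpace r → ℝ} (h1 : UniformlyLipschitz A M) (hA : Admissible β μ A) :
    StrongDual ℝ C(SymbSpace r, ℝ) →L[ℝ] StrongDual ℝ C(SymbSpace r, ℝ) :=
  ContinuousLinearMap.precomp ℝ (ruelleOp hβ hM h1 hA)

theorem integrable_of_continuousMap {r : ℕ} (ν : ProbabilityMeasure (SymbSpace r))
    (f : C(SymbSpace r, ℝ)) : Integrable f (ν : Measure (SymbSpace r)) :=
  f.continuous.integrable_of_hasCompactSupport (HasCompactSupport.of_compactSpace f)

/-- A Borel probability `ν`, seen as the element `f ↦ ∫ f dν` of `C(Ω)*`. -/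
noncomputable def integralFunctional {r : ℕ} (ν : ProbabilityMeasure (SymbSpace r)) :
    StrongDual ℝ C(SymbSpace r, ℝ) :=
  LinearMap.mkContinuous
    { toFun := fun f => ∫ x, f x ∂(ν : Measure (SymbSpace r))
      map_add' := fun f g =>
        integral_add (integrable_of_continuousMap ν f) (integrable_of_continuousMap ν g)
      map_smul' := fun c f => integral_const_mul c _ } 1 fun f => by
    have h := norm_integral_le_of_norm_le_const (μ := (ν : Measure (SymbSpace r)))
      (Eventually.of_forall fun x => f.norm_coe_le_norm x)
    simpa using h

/-- Strong superlinearity with `K' = log r / β + μ` and `δ = 0` gives admissibility (`r ≥ 2`). -/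
theorem admissible_of_stronglySuperlinear {r : ℕ} (hr : 2 ≤ r) {β μ : ℝ} (hβ : 0 < β)
    {A : ℕ → SymbSpace r → ℝ} (h3 : StronglySuperlinear A (Real.log r / β + μ) 0) :
    Admissible β μ A := by
  intro x
  have hr0 : (0 : ℝ) < r := by exact_mod_cast (by omega : 0 < r)
  have hr1 : ((r : ℝ))⁻¹ < 1 := inv_lt_one_of_one_lt₀ (by exact_mod_cast (by omega : 1 < r))
  refine Summable.of_nonneg_of_le (fun N => by positivity) (fun N => ?_)
    ((summable_geometric_of_lt_one (by positivity) hr1).mul_left (r : ℝ))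
  have key : ∀ a : Fin r, Real.exp (-β * A N (prepend a x)) ≤
      Real.exp (-(β * μ * N)) * ((r : ℝ)⁻¹) ^ N := by
    intro a
    have e : ((r : ℝ)⁻¹) ^ N = Real.exp (-(N * Real.log r)) := by
      rw [Real.exp_neg, Real.exp_nat_mul, Real.exp_log hr0, inv_pow]
    rw [e, ← Real.exp_add]
    refine Real.exp_le_exp.2 ?_
    have h := mul_lt_mul_of_pos_left (h3 N (prepend a x)) hβ
    have h2 : β * ((Real.log r / β + μ) * N + 0) = N * Real.log r + β * μ * N := by
      field_simp
      ring
    linarith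
  calc Real.exp (β * μ * N) * ∑ a : Fin r, Real.exp (-β * A N (prepend a x))
      ≤ Real.exp (β * μ * N) * ∑ _a : Fin r, Real.exp (-(β * μ * N)) * ((r : ℝ)⁻¹) ^ N :=
        mul_le_mul_of_nonneg_left (Finset.sum_le_sum fun a _ => key a) (Real.exp_pos _).le
    _ = r * ((r : ℝ)⁻¹) ^ N := by
        rw [Finset.sum_const, Finset.card_univ, Fintype.card_fin, nsmul_eq_mul, Real.exp_neg]
        field_simp

/-- The maps of the countable IFS: `φ_j(x) = (j mod r) x`, for `j ≥ 0`. -/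
def ifsMap {r : ℕ} [NeZero r] (j : ℕ) (x : SymbSpace r) : SymbSpace r :=
  prepend ⟨j % r, Nat.mod_lt j (NeZero.pos r)⟩ x

/-- `φ_w = φ_{w_1} ∘ ⋯ ∘ φ_{w_n}` (the identity for the empty word). -/
def ifsWordMap {r : ℕ} [NeZero r] (w : List ℕ) (x : SymbSpace r) : SymbSpace r :=
  w.foldr ifsMap x

/-- `ξ(j) = (j - (j mod r)) / r`. -/
def levelIndex (r j : ℕ) : ℕ := (j - j % r) / r

/-- The weights `q_j(x) = -β (A_{ξ(j)}(φ_j(x)) - ξ(j) μ)`. -/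
noncomputable def ifsWeight {r : ℕ} [NeZero r] (β μ : ℝ) (A : ℕ → SymbSpace r → ℝ) (j : ℕ)
    (x : SymbSpace r) : ℝ :=
  -β * (A (levelIndex r j) (ifsMap j x) - levelIndex r j * μ)

/-- `∑_{j=1}^n q_{w_j}(φ_{σ^j(w)}(x))` for a word `w` of length `n`, where `σ^j(w)` is `w` without
its first `j` letters. The index `j` below runs from `0` to `n - 1`. -/
noncomputable def wordSum {r : ℕ} [NeZero r] (Q : ℕ → SymbSpace r → ℝ) {n : ℕ} (w : Fin n → ℕ)
    (x : SymbSpace r) : ℝ :=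
  ∑ j : Fin n, Q (w j) (ifsWordMap ((List.ofFn w).drop (j + 1)) x)

/-- The summand `exp (sup_x ∑_j q_{w_j}(φ_{σ^j(w)}(x)))` of the partition function. -/
noncomputable def partitionTerm {r : ℕ} [NeZero r] (Q : ℕ → SymbSpace r → ℝ) {n : ℕ}
    (w : Fin n → ℕ) : ℝ :=
  Real.exp (⨆ x : SymbSpace r, wordSum Q w x)

/-- The partition function `Z_n(Q)`: the sum over all words of length `n` over `ℕ`. -/
noncomputable def partitionFunction {r : ℕ} [NeZero r] (Q : ℕ → SymbSpace r → ℝ) (n : ℕ) : ℝ :=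
  ∑' w : Fin n → ℕ, partitionTerm Q w

/-- The topological pressure `P(Q) = lim_n (1/n) log Z_n(Q)`. -/
noncomputable def topPressure {r : ℕ} [NeZero r] (Q : ℕ → SymbSpace r → ℝ) : ℝ :=
  limUnder atTop fun n : ℕ => 1 / (n : ℝ) * Real.log (partitionFunction Q n)

/-! Writing j = rN + a turns the operator L into the transfer operator of the countable IFS, L f =
∑_j exp(q_j) · f∘φ_j (`hasSum_ruelleOp`), so L^n 1(x) is the sum of exp(`wordSum` w x) over words w
of length n (`hasSum_ruelleOp_pow`). Since the φ_j contract by 1/2 and the A_N are uniformly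
Lipschitz, `wordSum` varies with x by at most βM, uniformly in n and w (`abs_wordSum_sub_le`). Hence
L^n 1(x) ≤ Z_n ≤ e^{βM} L^n 1(x) for every x. If L*ν = λν, integrating against ν gives λ^n ≤ Z_n ≤
e^{βM} λ^n. Taking logarithms, log λ is both the limit and the infimum of (1/n) log Z_n, whichever
eigenpair is used.

An eigenpair exists by the same distortion bound (`exists_eigenprobability`): log L^n 1(x) is
additive in n up to a bounded error, hence within bounded distance of n·l. Weighted averages of f ↦
e^{-kl} L^k f(x) then have an ultralimit Φ that is positive, normalized and satisfies Φ∘L = e^l Φ,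
and Riesz representation turns Φ into a measure. Superlinearity enters only through the convergence
of the series defining L. -/

/-! ### Almost additive sequences and ultralimits of functionals -/

/-- A sequence that is additive up to a bounded error stays within bounded distance of a linear
one. -/
theorem exists_abs_sub_mul_le_of_abs_add_sub_le {u : ℕ → ℝ} {C : ℝ}
    (h : ∀ m n, |u (m + n) - u m - u n| ≤ C) : ∃ l : ℝ, ∀ n : ℕ, |u n - n * l| ≤ C := by
  have h0 : |u 0| ≤ C := by
    have := h 0 0
    rwa [add_zero, sub_self, zero_sub, abs_neg] at this
  have hgrow : ∀ n : ℕ, |u n| ≤ n * (|u 1| + C) + C := by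
    intro n
    induction n with
    | zero => simpa using h0
    | succ n ih =>
      have := abs_le.1 (h n 1)
      have h1 := abs_le.1 (le_refl |u 1|)
      have h2 := abs_le.1 ih
      push_cast
      exact abs_le.2 ⟨by linarith, by linarith⟩
  have hC : 0 ≤ C := (abs_nonneg _).trans h0
  have hbdd : ∀ n : ℕ, |u n / n| ≤ |u 1| + C + C := by
    intro n
    rcases Nat.eq_zero_or_pos n with rfl | hn
    · simpa using by positivity
    · have hn' : (1 : ℝ) ≤ n := by exact_mod_cast hn
      rw [abs_div, Nat.abs_cast, div_le_iff₀ (by positivity)]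
      nlinarith [hgrow n]
  -- Fekete's lemma is applied to both u + C and C - u: each limit is an infimum, so together they
  -- bound u from both sides once the two limits are known to be opposite.
  have hsub1 : Subadditive fun n => u n + C := fun m n => by
    have := abs_le.1 (h m n)
    simp only
    linarith
  have hsub2 : Subadditive fun n => C - u n := fun m n => by
    have := abs_le.1 (h m n)
    simp only
    linarith
  have hCdiv : ∀ n : ℕ, 0 ≤ C / n := fun n => by positivity
  have hb1 : BddBelow (Set.range fun n : ℕ => (u n + C) / n) := by
    refine ⟨-(|u 1| + C + C), ?_⟩
    rintro _ ⟨n, rfl⟩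
    have := (abs_le.1 (hbdd n)).1
    simp only [add_div]
    linarith [hCdiv n]
  have hb2 : BddBelow (Set.range fun n : ℕ => (C - u n) / n) := by
    refine ⟨-(|u 1| + C + C), ?_⟩
    rintro _ ⟨n, rfl⟩
    have := (abs_le.1 (hbdd n)).2
    simp only [sub_div]
    linarith [hCdiv n]
  have hlim : hsub1.lim + hsub2.lim = 0 := by
    refine tendsto_nhds_unique ((hsub1.tendsto_lim hb1).add (hsub2.tendsto_lim hb2)) ?_
    refine (tendsto_const_div_atTop_nhds_zero_nat (C + C)).congr fun n => ?_
    ring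
  refine ⟨hsub1.lim, fun n => ?_⟩
  rcases Nat.eq_zero_or_pos n with rfl | hn
  · simpa using h0
  · have hn' : (0 : ℝ) < n := by exact_mod_cast hn
    have e1 := hsub1.lim_le_div hb1 hn.ne'
    have e2 := hsub2.lim_le_div hb2 hn.ne'
    rw [le_div_iff₀ hn'] at e1 e2
    rw [show hsub2.lim = -hsub1.lim by linarith] at e2
    exact abs_le.2 ⟨by linarith, by linarith⟩

/-- A sequence of linear functionals bounded by the norm has a limit along an ultrafilter. -/
theorem exists_linearMap_tendsto_hyperfilter {E : Type*} [SeminormedAddCommGroup E]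
    [NormedSpace ℝ E] (Λ : ℕ → E →ₗ[ℝ] ℝ) (h : ∀ n f, |Λ n f| ≤ ‖f‖) :
    ∃ Φ : E →ₗ[ℝ] ℝ, ∀ f, Tendsto (fun n => Λ n f) (hyperfilter ℕ) (𝓝 (Φ f)) := by
  have hex : ∀ f, ∃ l, Tendsto (fun n => Λ n f) (hyperfilter ℕ) (𝓝 l) := by
    intro f
    obtain ⟨l, -, hl⟩ := (isCompact_Icc (a := -‖f‖) (b := ‖f‖)).ultrafilter_le_nhds'
      ((hyperfilter ℕ).map fun n => Λ n f)
      (Ultrafilter.mem_map.2 (Filter.univ_mem' fun n => abs_le.1 (h n f)))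
    exact ⟨l, hl⟩
  choose Φ hΦ using hex
  refine ⟨⟨⟨Φ, fun f g => ?_⟩, fun c f => ?_⟩, hΦ⟩
  · refine tendsto_nhds_unique (hΦ (f + g)) (((hΦ f).add (hΦ g)).congr fun n => ?_)
    rw [map_add]
  · refine tendsto_nhds_unique (hΦ (c • f)) (((hΦ f).const_smul c).congr fun n => ?_)
    rw [map_smul]

/-! ### Eigenprobabilities of positive operators with bounded distortion -/

section Eigenmeasure

variable {X : Type*} [TopologicalSpace X] [CompactSpace X]

/-- Riesz–Markov–Kakutani for a normalized positive functional on a compact space. -/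
theorem exists_probabilityMeasure_integral_eq [T2Space X] [MeasurableSpace X] [BorelSpace X]
    (Φ : C(X, ℝ) →ₗ[ℝ] ℝ) (hpos : ∀ f, 0 ≤ f → 0 ≤ Φ f) (hone : Φ 1 = 1) :
    ∃ ν : ProbabilityMeasure X, ∀ f : C(X, ℝ), ∫ x, f x ∂(ν : Measure X) = Φ f := by
  let Λ : CompactlySupportedContinuousMap X ℝ →ₚ[ℝ] ℝ := PositiveLinearMap.mk₀
    { toFun := fun f => Φ f.toContinuousMap
      map_add' := fun f g => Φ.map_add f.toContinuousMap g.toContinuousMap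
      map_smul' := fun c f => Φ.map_smul c f.toContinuousMap }
    fun f hf => hpos _ hf
  have hint : ∀ f : C(X, ℝ), ∫ x, f x ∂(RealRMK.rieszMeasure Λ) = Φ f := fun f =>
    RealRMK.integral_rieszMeasure Λ (CompactlySupportedContinuousMap.continuousMapEquiv f)
  have hprob : IsProbabilityMeasure (RealRMK.rieszMeasure Λ) := by
    have h1 := hint 1
    rw [hone] at h1
    simp only [ContinuousMap.one_apply, integral_const, smul_eq_mul, mul_one] at h1
    rw [measureReal_def, ENNReal.toReal_eq_one_iff] at h1
    exact ⟨h1⟩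
  exact ⟨⟨RealRMK.rieszMeasure Λ, hprob⟩, hint⟩

variable {L : C(X, ℝ) →L[ℝ] C(X, ℝ)}

theorem monotone_pow_of_nonneg (hpos : ∀ f, 0 ≤ f → 0 ≤ L f) (n : ℕ) {f g : C(X, ℝ)}
    (hfg : f ≤ g) : (L ^ n) f ≤ (L ^ n) g := by
  induction n with
  | zero => simpa using hfg
  | succ n ih =>
    rw [pow_succ', mul_apply_eq_comp, mul_apply_eq_comp, ← sub_nonneg,
      ← map_sub]
    exact hpos _ (sub_nonneg.2 ih)

theorem abs_pow_apply_le (hpos : ∀ f, 0 ≤ f → 0 ≤ L f) (n : ℕ) (f : C(X, ℝ)) (x : X) :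
    |(L ^ n) f x| ≤ (L ^ n) 1 x * ‖f‖ := by
  have h1 : f ≤ ‖f‖ • 1 := fun y => by simpa using (abs_le.1 (f.norm_coe_le_norm y)).2
  have h2 : (-‖f‖) • 1 ≤ f := fun y => by simpa using (abs_le.1 (f.norm_coe_le_norm y)).1
  have e1 := ContinuousMap.le_def.1 (monotone_pow_of_nonneg hpos n h1) x
  have e2 := ContinuousMap.le_def.1 (monotone_pow_of_nonneg hpos n h2) x
  rw [map_smul, ContinuousMap.smul_apply, smul_eq_mul] at e1 e2
  exact abs_le.2 ⟨by linarith, by linarith⟩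

/-- A positive operator on `C(X)` whose iterates of `1` have uniformly bounded distortion grows
exactly exponentially. -/
theorem exists_exp_growth (hpos : ∀ f, 0 ≤ f → 0 ≤ L f) {K : ℝ}
    (hL : ∀ n x, 0 < (L ^ n) 1 x) (hK : ∀ n x y, (L ^ n) 1 x ≤ Real.exp K * (L ^ n) 1 y) (x : X) :
    ∃ l : ℝ, ∀ n : ℕ, |Real.log ((L ^ n) 1 x) - n * l| ≤ K := by
  refine exists_abs_sub_mul_le_of_abs_add_sub_le fun m n => ?_
  have hmn : (L ^ (m + n)) 1 x = (L ^ m) ((L ^ n) 1) x := by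
    rw [pow_add, mul_apply_eq_comp]
  -- By distortion, L^n 1 lies between e^{-K} and e^K times its value at x; applying the monotone
  -- L^m keeps these bounds.
  have hup : (L ^ n) 1 ≤ (Real.exp K * (L ^ n) 1 x) • 1 := fun y => by simpa using hK n y x
  have hlow : (Real.exp (-K) * (L ^ n) 1 x) • 1 ≤ (L ^ n) 1 := fun y => by
    have := mul_le_mul_of_nonneg_left (hK n x y) (Real.exp_pos (-K)).le
    rw [← mul_assoc, ← Real.exp_add, neg_add_cancel, Real.exp_zero, one_mul] at this
    simpa using this
  have e1 := ContinuousMap.le_def.1 (monotone_pow_of_nonneg hpos m hup) x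
  have e2 := ContinuousMap.le_def.1 (monotone_pow_of_nonneg hpos m hlow) x
  rw [map_smul, ContinuousMap.smul_apply, smul_eq_mul, ← hmn] at e1 e2
  have hm := hL m x
  have hn := hL n x
  have f1 := Real.log_le_log (hL _ x) e1
  have f2 := Real.log_le_log (by positivity) e2
  rw [Real.log_mul (by positivity) hm.ne', Real.log_mul (by positivity) hn.ne', Real.log_exp]
    at f1 f2
  exact abs_le.2 ⟨by linarith, by linarith⟩

/-- A positive operator on `C(X)` whose iterates of `1` have uniformly bounded distortion has an
eigenprobability. -/
theorem exists_eigenprobability [T2Space X] [Nonempty X] [MeasurableSpace X] [BorelSpace X]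
    (hpos : ∀ f, 0 ≤ f → 0 ≤ L f) {K : ℝ}
    (hL : ∀ n x, 0 < (L ^ n) 1 x) (hK : ∀ n x y, (L ^ n) 1 x ≤ Real.exp K * (L ^ n) 1 y) :
    ∃ (ν : ProbabilityMeasure X) (lam : ℝ), ∀ f : C(X, ℝ),
      ∫ x, L f x ∂(ν : Measure X) = lam * ∫ x, f x ∂(ν : Measure X) := by
  obtain ⟨x⟩ := ‹Nonempty X›
  obtain ⟨l, hl⟩ := exists_exp_growth hpos hL hK x
  let P : ℕ → C(X, ℝ) →ₗ[ℝ] ℝ := fun k =>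
    { toFun := fun f => Real.exp (-(k * l)) * (L ^ k) f x
      map_add' := fun f g => by rw [map_add, ContinuousMap.add_apply, mul_add]
      map_smul' := fun c f => by
        rw [map_smul, ContinuousMap.smul_apply, smul_eq_mul, RingHom.id_apply, smul_eq_mul]
        ring }
  have hP : ∀ k f, P k f = Real.exp (-(k * l)) * (L ^ k) f x := fun _ _ => rfl
  -- Up to the factor e^l, applying L shifts k by one, so averages over k are almost
  -- eigenfunctionals.
  have hPL : ∀ k f, P k (L f) = Real.exp l * P (k + 1) f := fun k f => by
    rw [hP, hP, pow_succ, mul_apply_eq_comp, ← mul_assoc, ← Real.exp_add]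
    push_cast
    ring_nf
  have hP1 : ∀ k, P k 1 = Real.exp (Real.log ((L ^ k) 1 x) - k * l) := fun k => by
    rw [hP, sub_eq_add_neg, Real.exp_add, Real.exp_log (hL k x), mul_comm]
  have hPup : ∀ k, P k 1 ≤ Real.exp K := fun k => by
    rw [hP1]
    exact Real.exp_le_exp.2 (abs_le.1 (hl k)).2
  have hPlow : ∀ k, Real.exp (-K) ≤ P k 1 := fun k => by
    rw [hP1]
    exact Real.exp_le_exp.2 (abs_le.1 (hl k)).1
  have hPabs : ∀ k f, |P k f| ≤ P k 1 * ‖f‖ := fun k f => by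
    rw [hP, hP, abs_mul, abs_of_pos (Real.exp_pos _), mul_assoc]
    exact mul_le_mul_of_nonneg_left (abs_pow_apply_le hpos k f x) (Real.exp_pos _).le
  have hPnn : ∀ k f, 0 ≤ f → 0 ≤ P k f := fun k f hf => by
    have := ContinuousMap.le_def.1 (monotone_pow_of_nonneg hpos k hf) x
    rw [map_zero] at this
    exact mul_nonneg (Real.exp_pos _).le this
  let D : ℕ → ℝ := fun n => ∑ k ∈ Finset.range n, P k 1
  have hD0 : ∀ n, 0 ≤ D n := fun n =>
    Finset.sum_nonneg fun k _ => (Real.exp_pos _).le.trans (hPlow k)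
  have hDlow : ∀ n, n * Real.exp (-K) ≤ D n := fun n => by
    simpa using Finset.card_nsmul_le_sum (Finset.range n) (fun k => P k 1) _ fun k _ => hPlow k
  have hDtop : Tendsto D atTop atTop :=
    tendsto_atTop_mono hDlow (tendsto_natCast_atTop_atTop.atTop_mul_const (Real.exp_pos _))
  -- Dividing by the total mass D n, rather than by n, gives Λ n 1 = 1 as soon as D n > 0; for n = 0
  -- the functional is zero, which still satisfies the norm bound.
  let Λ : ℕ → C(X, ℝ) →ₗ[ℝ] ℝ := fun n => (D n)⁻¹ • ∑ k ∈ Finset.range n, P k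
  have hΛ : ∀ n f, Λ n f = (D n)⁻¹ * ∑ k ∈ Finset.range n, P k f := fun n f => by
    simp [Λ, LinearMap.sum_apply]
  have hbound : ∀ n f, |Λ n f| ≤ ‖f‖ := fun n f => by
    rw [hΛ, abs_mul, abs_of_nonneg (inv_nonneg.2 (hD0 n))]
    calc (D n)⁻¹ * |∑ k ∈ Finset.range n, P k f| ≤ (D n)⁻¹ * (D n * ‖f‖) := by
          refine mul_le_mul_of_nonneg_left ?_ (inv_nonneg.2 (hD0 n))
          rw [Finset.sum_mul]
          exact (Finset.abs_sum_le_sum_abs _ _).trans (Finset.sum_le_sum fun k _ => hPabs k f)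
      _ = ((D n)⁻¹ * D n) * ‖f‖ := by ring
      _ ≤ 1 * ‖f‖ := by gcongr; exact inv_mul_le_one
      _ = ‖f‖ := one_mul _
  obtain ⟨Φ, hΦ⟩ := exists_linearMap_tendsto_hyperfilter Λ hbound
  have hle : (hyperfilter ℕ : Filter ℕ) ≤ atTop := Nat.hyperfilter_le_atTop
  have hΦpos : ∀ f, 0 ≤ f → 0 ≤ Φ f := fun f hf => by
    refine ge_of_tendsto' (hΦ f) fun n => ?_
    rw [hΛ]
    exact mul_nonneg (inv_nonneg.2 (hD0 n)) (Finset.sum_nonneg fun k _ => hPnn k f hf)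
  have hΦ1 : Φ 1 = 1 := by
    refine tendsto_nhds_unique (hΦ 1) (tendsto_const_nhds.congr' ?_)
    filter_upwards [hle (hDtop.eventually_gt_atTop 0)] with n hn
    rw [hΛ]
    exact (inv_mul_cancel₀ (ne_of_gt hn)).symm
  have hΦL : ∀ f, Φ (L f) = Real.exp l * Φ f := fun f => by
    -- The shifted sum differs from the original one only by the boundary terms P n f - P 0 f, which
    -- stay bounded while D n tends to infinity.
    have hstep : ∀ n, Λ n (L f) =
        Real.exp l * Λ n f + Real.exp l * ((D n)⁻¹ * (P n f - P 0 f)) := fun n => by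
      have hs := (Finset.sum_range_succ (fun k => P k f) n).symm.trans
        (Finset.sum_range_succ' (fun k => P k f) n)
      simp only [hΛ, hPL, ← Finset.mul_sum]
      linear_combination -(Real.exp l * (D n)⁻¹) * hs
    have hzero : Tendsto (fun n => (D n)⁻¹ * (P n f - P 0 f)) atTop (𝓝 0) := by
      refine hDtop.inv_tendsto_atTop.zero_mul_isBoundedUnder_le ?_
      refine isBoundedUnder_of ⟨Real.exp K * ‖f‖ + |P 0 f|, fun n => ?_⟩
      refine (abs_sub _ _).trans (add_le_add_left ((hPabs n f).trans ?_) _)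
      exact mul_le_mul_of_nonneg_right (hPup n) (norm_nonneg f)
    have hlim := ((hΦ f).const_mul (Real.exp l)).add ((hzero.mono_left hle).const_mul (Real.exp l))
    rw [mul_zero, add_zero] at hlim
    exact tendsto_nhds_unique (hΦ (L f)) (hlim.congr fun n => (hstep n).symm)
  obtain ⟨ν, hν⟩ := exists_probabilityMeasure_integral_eq Φ hΦpos hΦ1
  exact ⟨ν, Real.exp l, fun f => by rw [hν, hν, hΦL]⟩

end Eigenmeasure

/-! ### Iterated sums and contraction -/

theorem hasSum_prod_of_nonneg {ι κ : Type*} {f : ι × κ → ℝ} (hf : ∀ p, 0 ≤ f p) {g : ι → ℝ}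
    {s : ℝ} (h1 : ∀ a, HasSum (fun b => f (a, b)) (g a)) (h2 : HasSum g s) : HasSum f s := by
  have hs : Summable f := (summable_prod_of_nonneg hf).2
    ⟨fun a => (h1 a).summable, h2.summable.congr fun a => (h1 a).tsum_eq.symm⟩
  rw [← (hs.hasSum.prod_fiberwise h1).unique h2]
  exact hs.hasSum

theorem symbDist_prepend_le {r : ℕ} (a : Fin r) (x y : SymbSpace r) :
    symbDist (prepend a x) (prepend a y) ≤ 1 / 2 * symbDist x y := by
  by_cases hxy : x = y
  · simp [hxy, symbDist]
  -- If the images coincide, the left side is zero, so injectivity of `prepend` is not needed.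
  by_cases hp : prepend a x = prepend a y
  · have := symbDist_nonneg x y
    rw [symbDist, if_pos hp]
    positivity
  · rw [symbDist, symbDist, if_neg hp, if_neg hxy, ← pow_succ']
    refine pow_le_pow_of_le_one (by norm_num) (by norm_num) (Nat.succ_le_succ ?_)
    refine (PiNat.mem_cylinder_iff_le_firstDiff hp _).1 fun i hi => ?_
    cases i with
    | zero => rfl
    | succ i => exact PiNat.apply_eq_of_lt_firstDiff (x := x) (y := y) (Nat.succ_lt_succ_iff.1 hi)

/-! ### Iterated function system, partition function and pressure -/

section IFS

variable {r : ℕ} [NeZero r]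

theorem symbDist_ifsWordMap_le (l : List ℕ) (x y : SymbSpace r) :
    symbDist (ifsWordMap l x) (ifsWordMap l y) ≤ (1 / 2) ^ l.length := by
  induction l with
  | nil => exact symbDist_le_one _ _
  | cons j l ih =>
    rw [List.length_cons, pow_succ']
    exact (symbDist_prepend_le _ _ _).trans (mul_le_mul_of_nonneg_left ih (by norm_num))

theorem wordSum_cons (Q : ℕ → SymbSpace r → ℝ) {n : ℕ} (j : ℕ) (w : Fin n → ℕ)
    (x : SymbSpace r) :
    wordSum Q (Fin.cons j w : Fin (n + 1) → ℕ) x =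
      Q j (ifsWordMap (List.ofFn w) x) + wordSum Q w x := by
  simp [wordSum, Fin.sum_univ_succ, List.ofFn_succ]

variable {β μ M : ℝ} {A : ℕ → SymbSpace r → ℝ}

/-- Bounded distortion: a letter followed by k others evaluates A at two points sharing their first
k + 1 letters, contributing at most βM·2^{-(k+1)}. The exact geometric sum is kept so that the
induction closes. -/
theorem abs_wordSum_sub_le (hβ : 0 < β) (hM : 0 < M) (h1 : UniformlyLipschitz A M) {n : ℕ}
    (w : Fin n → ℕ) (x y : SymbSpace r) :
    |wordSum (ifsWeight β μ A) w x - wordSum (ifsWeight β μ A) w y| ≤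
      β * M * (1 - (1 / 2) ^ n) := by
  induction n with
  | zero => simp [wordSum]
  | succ n ih =>
    induction w using Fin.consCases with
    | cons j w =>
      have hd : symbDist (ifsMap j (ifsWordMap (List.ofFn w) x))
          (ifsMap j (ifsWordMap (List.ofFn w) y)) ≤ (1 / 2) ^ (n + 1) := by
        have := symbDist_ifsWordMap_le (j :: List.ofFn w) x y
        rwa [List.length_cons, List.length_ofFn] at this
      have hA := (h1 (levelIndex r j) _ _).trans (mul_le_mul_of_nonneg_left hd hM.le)
      have hw : |ifsWeight β μ A j (ifsWordMap (List.ofFn w) x) -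
          ifsWeight β μ A j (ifsWordMap (List.ofFn w) y)| ≤ β * (M * (1 / 2) ^ (n + 1)) := by
        refine le_trans (le_of_eq ?_) (mul_le_mul_of_nonneg_left hA hβ.le)
        rw [← abs_of_pos hβ, ← abs_mul, ← abs_neg, abs_of_pos hβ]
        congr 1
        simp only [ifsWeight]
        ring
      rw [wordSum_cons, wordSum_cons, add_sub_add_comm]
      refine (abs_add_le _ _).trans ((add_le_add hw (ih w)).trans (le_of_eq ?_))
      ring

theorem wordSum_le_add (hβ : 0 < β) (hM : 0 < M) (h1 : UniformlyLipschitz A M) {n : ℕ}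
    (w : Fin n → ℕ) (x y : SymbSpace r) :
    wordSum (ifsWeight β μ A) w x ≤ β * M + wordSum (ifsWeight β μ A) w y := by
  have h := (abs_le.1 (abs_wordSum_sub_le (μ := μ) hβ hM h1 w x y)).2
  have : 0 ≤ β * M * (1 / 2) ^ n := by positivity
  linarith

theorem exp_wordSum_le_partitionTerm (hβ : 0 < β) (hM : 0 < M) (h1 : UniformlyLipschitz A M)
    {n : ℕ} (w : Fin n → ℕ) (x : SymbSpace r) :
    Real.exp (wordSum (ifsWeight β μ A) w x) ≤ partitionTerm (ifsWeight β μ A) w :=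
  Real.exp_le_exp.2 <| le_ciSup (f := fun y => wordSum (ifsWeight β μ A) w y)
    -- The real supremum is meaningful only for a bounded family; distortion relative to x supplies
    -- the bound.
    ⟨_, Set.forall_mem_range.2 fun y => wordSum_le_add hβ hM h1 w y x⟩ x

theorem partitionTerm_le (hβ : 0 < β) (hM : 0 < M) (h1 : UniformlyLipschitz A M) {n : ℕ}
    (w : Fin n → ℕ) (x : SymbSpace r) :
    partitionTerm (ifsWeight β μ A) w ≤
      Real.exp (β * M) * Real.exp (wordSum (ifsWeight β μ A) w x) := by
  have : Nonempty (SymbSpace r) := ⟨x⟩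
  rw [← Real.exp_add]
  exact Real.exp_le_exp.2 (ciSup_le fun y => wordSum_le_add hβ hM h1 w y x)

/-- Division with remainder identifies j with the pair (N, a); nonnegativity of f lets the iterated
sum over N and a be read as one sum over j. -/
theorem hasSum_ruelleOp (hβ : 0 < β) (hM : 0 < M) (h1 : UniformlyLipschitz A M)
    (hA : Admissible β μ A) {f : C(SymbSpace r, ℝ)} (hf : 0 ≤ f) (x : SymbSpace r) :
    HasSum (fun j => Real.exp (ifsWeight β μ A j x) * f (ifsMap j x))
      (ruelleOp hβ hM h1 hA f x) := by
  have hprod : HasSum (fun p : ℕ × Fin r => Real.exp (β * μ * p.1) *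
      (Real.exp (-β * A p.1 (prepend p.2 x)) * f (prepend p.2 x)))
      (ruelleOp hβ hM h1 hA f x) := by
    refine hasSum_prod_of_nonneg (fun p => ?_) (fun N => ?_)
      (summable_ruelleTerm hβ hM h1 hA f x).hasSum
    · exact mul_nonneg (Real.exp_pos _).le (mul_nonneg (Real.exp_pos _).le (hf _))
    · rw [ruelleTerm, Finset.mul_sum]
      exact hasSum_fintype _
  refine ((Nat.divModEquiv r).hasSum_iff.2 hprod).congr_fun fun j => ?_
  have hlev : levelIndex r j = j / r := by
    exact Nat.div_eq_sub_mod_div.symm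
  have hmap : ifsMap j x = prepend ((Nat.divModEquiv r) j).2 x := by
    rw [ifsMap]
    congr 1
  simp only [Function.comp, ifsWeight, hlev, hmap]
  rw [← mul_assoc, ← Real.exp_add]
  congr 2
  simp only [Nat.divModEquiv_apply]
  ring

theorem hasSum_ruelleOp_pow (hβ : 0 < β) (hM : 0 < M) (h1 : UniformlyLipschitz A M)
    (hA : Admissible β μ A) (n : ℕ) {f : C(SymbSpace r, ℝ)} (hf : 0 ≤ f) (x : SymbSpace r) :
    HasSum (fun w : Fin n → ℕ => Real.exp (wordSum (ifsWeight β μ A) w x) *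
      f (ifsWordMap (List.ofFn w) x)) ((ruelleOp hβ hM h1 hA ^ n) f x) := by
  induction n generalizing f with
  | zero => simp [wordSum, ifsWordMap]
  | succ n ih =>
    have hLf : 0 ≤ ruelleOp hβ hM h1 hA f := fun y =>
      (hasSum_ruelleOp hβ hM h1 hA hf y).nonneg fun j => mul_nonneg (Real.exp_pos _).le (hf _)
    rw [pow_succ, mul_apply_eq_comp]
    -- In L^n (L f) the factor L f is evaluated at φ_w(x), so its letter j is the outermost map and
    -- goes at the head of the word.
    let e : (Fin n → ℕ) × ℕ ≃ (Fin (n + 1) → ℕ) :=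
      (Equiv.prodComm _ _).trans (Fin.consEquiv fun _ => ℕ)
    rw [← e.hasSum_iff]
    refine hasSum_prod_of_nonneg (fun p => mul_nonneg (Real.exp_pos _).le (hf _)) (fun w => ?_)
      (ih hLf)
    refine ((hasSum_ruelleOp hβ hM h1 hA hf (ifsWordMap (List.ofFn w) x)).mul_left
      (Real.exp (wordSum (ifsWeight β μ A) w x))).congr_fun fun j => ?_
    have he : e (w, j) = Fin.cons j w := rfl
    have hmap : ifsWordMap (List.ofFn (Fin.cons j w : Fin (n + 1) → ℕ)) x =
        ifsMap j (ifsWordMap (List.ofFn w) x) := by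
      rw [List.ofFn_cons]
      rfl
    rw [he, ← mul_assoc, ← Real.exp_add, add_comm (wordSum _ w x), ← wordSum_cons, ← hmap]
    rfl

theorem hasSum_exp_wordSum (hβ : 0 < β) (hM : 0 < M) (h1 : UniformlyLipschitz A M)
    (hA : Admissible β μ A) (n : ℕ) (x : SymbSpace r) :
    HasSum (fun w : Fin n → ℕ => Real.exp (wordSum (ifsWeight β μ A) w x))
      ((ruelleOp hβ hM h1 hA ^ n) 1 x) := by
  simpa using hasSum_ruelleOp_pow hβ hM h1 hA n (f := 1) zero_le_one x

theorem summable_partitionTerm (hβ : 0 < β) (hM : 0 < M) (h1 : UniformlyLipschitz A M)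
    (hA : Admissible β μ A) (n : ℕ) :
    Summable fun w : Fin n → ℕ => partitionTerm (ifsWeight β μ A) w :=
  Summable.of_nonneg_of_le (fun _ => (Real.exp_pos _).le)
    (fun w => partitionTerm_le hβ hM h1 w fun _ => 0)
    ((hasSum_exp_wordSum hβ hM h1 hA n _).summable.mul_left _)

theorem ruelleOp_pow_one_le_partitionFunction (hβ : 0 < β) (hM : 0 < M)
    (h1 : UniformlyLipschitz A M) (hA : Admissible β μ A) (n : ℕ) (x : SymbSpace r) :
    (ruelleOp hβ hM h1 hA ^ n) 1 x ≤ partitionFunction (ifsWeight β μ A) n :=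
  hasSum_le (fun w => exp_wordSum_le_partitionTerm hβ hM h1 w x)
    (hasSum_exp_wordSum hβ hM h1 hA n x) (summable_partitionTerm hβ hM h1 hA n).hasSum

theorem partitionFunction_le (hβ : 0 < β) (hM : 0 < M) (h1 : UniformlyLipschitz A M)
    (hA : Admissible β μ A) (n : ℕ) (x : SymbSpace r) :
    partitionFunction (ifsWeight β μ A) n ≤
      Real.exp (β * M) * (ruelleOp hβ hM h1 hA ^ n) 1 x :=
  hasSum_le (fun w => partitionTerm_le hβ hM h1 w x)
    (summable_partitionTerm hβ hM h1 hA n).hasSum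
    ((hasSum_exp_wordSum hβ hM h1 hA n x).mul_left _)

theorem ruelleOp_pow_one_pos (hβ : 0 < β) (hM : 0 < M) (h1 : UniformlyLipschitz A M)
    (hA : Admissible β μ A) (n : ℕ) (x : SymbSpace r) :
    0 < (ruelleOp hβ hM h1 hA ^ n) 1 x :=
  -- One word already gives a positive lower bound; the word of zeros is taken.
  (Real.exp_pos _).trans_le <| le_hasSum (hasSum_exp_wordSum hβ hM h1 hA n x) (fun _ => 0)
    fun _ _ => (Real.exp_pos _).le

theorem exists_eigenprobability_dualRuelleOp (hβ : 0 < β) (hM : 0 < M)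
    (h1 : UniformlyLipschitz A M) (hA : Admissible β μ A) :
    ∃ (ν : ProbabilityMeasure (SymbSpace r)) (lam : ℝ),
      dualRuelleOp hβ hM h1 hA (integralFunctional ν) = lam • integralFunctional ν := by
  obtain ⟨ν, lam, h⟩ := exists_eigenprobability (L := ruelleOp hβ hM h1 hA) (K := β * M)
    (fun f hf y =>
      (hasSum_ruelleOp hβ hM h1 hA hf y).nonneg fun j => mul_nonneg (Real.exp_pos _).le (hf _))
    (ruelleOp_pow_one_pos hβ hM h1 hA)
    fun n x y => (ruelleOp_pow_one_le_partitionFunction hβ hM h1 hA n x).trans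
      (partitionFunction_le hβ hM h1 hA n y)
  exact ⟨ν, lam, ContinuousLinearMap.ext h⟩

theorem integral_ruelleOp_pow_one (hβ : 0 < β) (hM : 0 < M) (h1 : UniformlyLipschitz A M)
    (hA : Admissible β μ A) {ν : ProbabilityMeasure (SymbSpace r)} {lam : ℝ}
    (h : dualRuelleOp hβ hM h1 hA (integralFunctional ν) = lam • integralFunctional ν) (n : ℕ) :
    ∫ x, (ruelleOp hβ hM h1 hA ^ n) 1 x ∂(ν : Measure (SymbSpace r)) = lam ^ n := by
  have hL : ∀ f, ∫ x, ruelleOp hβ hM h1 hA f x ∂(ν : Measure (SymbSpace r)) =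
      lam * ∫ x, f x ∂(ν : Measure (SymbSpace r)) := fun f => DFunLike.congr_fun h f
  induction n with
  | zero => simp
  | succ n ih => rw [pow_succ', mul_apply_eq_comp, hL, ih, pow_succ']

theorem pow_le_partitionFunction (hβ : 0 < β) (hM : 0 < M) (h1 : UniformlyLipschitz A M)
    (hA : Admissible β μ A) {ν : ProbabilityMeasure (SymbSpace r)} {lam : ℝ}
    (h : dualRuelleOp hβ hM h1 hA (integralFunctional ν) = lam • integralFunctional ν) (n : ℕ) :
    lam ^ n ≤ partitionFunction (ifsWeight β μ A) n := by
  rw [← integral_ruelleOp_pow_one hβ hM h1 hA h n]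
  simpa using integral_mono (integrable_of_continuousMap ν _) (integrable_const _)
    (ruelleOp_pow_one_le_partitionFunction hβ hM h1 hA n)

theorem partitionFunction_le_mul_pow (hβ : 0 < β) (hM : 0 < M) (h1 : UniformlyLipschitz A M)
    (hA : Admissible β μ A) {ν : ProbabilityMeasure (SymbSpace r)} {lam : ℝ}
    (h : dualRuelleOp hβ hM h1 hA (integralFunctional ν) = lam • integralFunctional ν) (n : ℕ) :
    partitionFunction (ifsWeight β μ A) n ≤ Real.exp (β * M) * lam ^ n := by
  rw [← integral_ruelleOp_pow_one hβ hM h1 hA h n, ← integral_const_mul]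
  simpa using integral_mono (integrable_const _)
    ((integrable_of_continuousMap ν _).const_mul _) (partitionFunction_le hβ hM h1 hA n)

/-- The eigenvalue is only assumed real; its sign follows from 0 < L 1 ≤ Z_1 ≤ e^{βM} λ. -/
theorem eigenvalue_pos (hβ : 0 < β) (hM : 0 < M) (h1 : UniformlyLipschitz A M)
    (hA : Admissible β μ A) {ν : ProbabilityMeasure (SymbSpace r)} {lam : ℝ}
    (h : dualRuelleOp hβ hM h1 hA (integralFunctional ν) = lam • integralFunctional ν) :
    0 < lam := by
  have h2 := (ruelleOp_pow_one_pos hβ hM h1 hA 1 fun _ => 0).trans_le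
    ((ruelleOp_pow_one_le_partitionFunction hβ hM h1 hA 1 _).trans
      (partitionFunction_le_mul_pow hβ hM h1 hA h 1))
  rw [pow_one] at h2
  exact pos_of_mul_pos_right h2 (Real.exp_pos _).le

/-- The bound λ^n ≤ Z_n carries no constant, which is what makes log λ a lower bound at every n ≥ 1
and not just in the limit. -/
theorem log_eigenvalue_le (hβ : 0 < β) (hM : 0 < M) (h1 : UniformlyLipschitz A M)
    (hA : Admissible β μ A) {ν : ProbabilityMeasure (SymbSpace r)} {lam : ℝ}
    (h : dualRuelleOp hβ hM h1 hA (integralFunctional ν) = lam • integralFunctional ν) {n : ℕ}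
    (hn : 1 ≤ n) :
    Real.log lam ≤ 1 / (n : ℝ) * Real.log (partitionFunction (ifsWeight β μ A) n) := by
  have hlam := eigenvalue_pos hβ hM h1 hA h
  have hn' : (0 : ℝ) < n := by exact_mod_cast hn
  have := Real.log_le_log (pow_pos hlam n) (pow_le_partitionFunction hβ hM h1 hA h n)
  rw [Real.log_pow] at this
  rw [one_div, inv_mul_eq_div, le_div_iff₀ hn']
  linarith

theorem tendsto_log_partitionFunction (hβ : 0 < β) (hM : 0 < M) (h1 : UniformlyLipschitz A M)
    (hA : Admissible β μ A) {ν : ProbabilityMeasure (SymbSpace r)} {lam : ℝ}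
    (h : dualRuelleOp hβ hM h1 hA (integralFunctional ν) = lam • integralFunctional ν) :
    Tendsto (fun n : ℕ => 1 / (n : ℝ) * Real.log (partitionFunction (ifsWeight β μ A) n)) atTop
      (𝓝 (Real.log lam)) := by
  have hlam := eigenvalue_pos hβ hM h1 hA h
  have hup : Tendsto (fun n : ℕ => β * M / n + Real.log lam) atTop (𝓝 (Real.log lam)) := by
    simpa using (tendsto_const_div_atTop_nhds_zero_nat (β * M)).add_const (Real.log lam)
  refine tendsto_of_tendsto_of_tendsto_of_le_of_le' tendsto_const_nhds hup ?_ ?_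
  · filter_upwards [eventually_ge_atTop 1] with n hn using log_eigenvalue_le hβ hM h1 hA h hn
  · filter_upwards [eventually_ge_atTop 1] with n hn
    have hn' : (0 : ℝ) < n := by exact_mod_cast hn
    have hZ := (pow_pos hlam n).trans_le (pow_le_partitionFunction hβ hM h1 hA h n)
    have := Real.log_le_log hZ (partitionFunction_le_mul_pow hβ hM h1 hA h n)
    rw [Real.log_mul (Real.exp_pos _).ne' (pow_pos hlam n).ne', Real.log_exp, Real.log_pow] at this
    rw [one_div, inv_mul_eq_div, div_le_iff₀ hn', add_mul, div_mul_cancel₀ _ hn'.ne']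
    linarith

theorem topPressure_eq_log_eigenvalue (hβ : 0 < β) (hM : 0 < M) (h1 : UniformlyLipschitz A M)
    (hA : Admissible β μ A) {ν : ProbabilityMeasure (SymbSpace r)} {lam : ℝ}
    (h : dualRuelleOp hβ hM h1 hA (integralFunctional ν) = lam • integralFunctional ν) :
    topPressure (ifsWeight β μ A) = Real.log lam :=
  (tendsto_log_partitionFunction hβ hM h1 hA h).limUnder_eq

end IFS

/-! ### The main theorem -/

theorem mainTheorem6 (r : ℕ) [NeZero r] (hr : 2 ≤ r) (β μ M : ℝ) (hβ : 0 < β) (hμ : μ < 0)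
    (hM : 0 < M) (A : ℕ → SymbSpace r → ℝ) (h1 : UniformlyLipschitz A M)
    (h3 : StronglySuperlinear A (Real.log r / β + μ) 0) :
    -- the partition functions are finite and the pressure exists as a limit and as an infimum
    (∀ n : ℕ, 1 ≤ n → Summable fun w : Fin n → ℕ => partitionTerm (ifsWeight β μ A) w) ∧
    Tendsto (fun n : ℕ => 1 / (n : ℝ) * Real.log (partitionFunction (ifsWeight β μ A) n)) atTop
      (𝓝 (topPressure (ifsWeight β μ A))) ∧
    IsGLB ((fun n : ℕ => 1 / (n : ℝ) * Real.log (partitionFunction (ifsWeight β μ A) n)) ''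
      Set.Ici 1) (topPressure (ifsWeight β μ A)) ∧
    -- the dual operator has an eigenprobability
    (∃ (ν : ProbabilityMeasure (SymbSpace r)) (lam : ℝ),
      dualRuelleOp hβ hM h1 (admissible_of_stronglySuperlinear hr hβ h3) (integralFunctional ν) =
        lam • integralFunctional ν) ∧
    -- its eigenvalue is the exponential of the pressure
    (∀ (ν : ProbabilityMeasure (SymbSpace r)) (lam : ℝ),
      dualRuelleOp hβ hM h1 (admissible_of_stronglySuperlinear hr hβ h3) (integralFunctional ν) =
        lam • integralFunctional ν →
      lam = Real.exp (topPressure (ifsWeight β μ A))) := by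
  have hA := admissible_of_stronglySuperlinear hr hβ h3
  obtain ⟨ν, lam, h⟩ := exists_eigenprobability_dualRuelleOp hβ hM h1 hA
  have hP := topPressure_eq_log_eigenvalue hβ hM h1 hA h
  have hlim := tendsto_log_partitionFunction hβ hM h1 hA h
  rw [← hP] at hlim
  refine ⟨fun n _ => summable_partitionTerm hβ hM h1 hA n, hlim, ⟨?_, fun b hb => ?_⟩,
    ⟨ν, lam, h⟩, fun ν' lam' h' => ?_⟩
  · rintro _ ⟨n, hn, rfl⟩
    rw [hP]
    exact log_eigenvalue_le hβ hM h1 hA h hn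
  -- A lower bound of all the terms is also a lower bound of their limit, so the limit is the
  -- greatest one.
  · refine ge_of_tendsto hlim ?_
    filter_upwards [eventually_ge_atTop 1] with n hn using hb ⟨n, hn, rfl⟩
  · rw [topPressure_eq_log_eigenvalue hβ hM h1 hA h',
      Real.exp_log (eigenvalue_pos hβ hM h1 hA h')]
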